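/- Let $(\mathcal{D},\mathbb{E},\mathfrak{s},\mathbb{E}^{-1})$ be an extriangulated category (in the sense of Nakaoka and Palu) with negative first extension: $\mathbb{E}^{-1}:\mathcal{D}^{op}\times\mathcal{D}\to\mathrm{Ab}$ is an additive bifunctor, and each $\delta\in\mathbb{E}(C,A)$ comes with natural transformations $\delta^{-1}:\mathbb{E}^{-1}(-,C)\to\mathcal{D}(-,A)$ and $\delta_{-1}:\mathbb{E}^{-1}(A,-)\to\mathcal{D}(C,-)$ such that, for every $\mathfrak{s}$-conflation $A\xrightarrow{u}B\xrightarrow{v}C$ realizing $\delta$ and every $W\in\mathcal{D}$, the sequences $$\mathbb{E}^{-1}(W,A)\to\mathbb{E}^{-1}(W,B)\to\mathbb{E}^{-1}(W,C)\xrightarrow{\delta^{-1}}\mathcal{D}(W,A)\to\mathcal{D}(W,B),$$ $$\mathbb{E}^{-1}(C,W)\to\mathbb{E}^{-1}(B,W)\to\mathbb{E}^{-1}(A,W)\xrightarrow{\delta_{-1}}\mathcal{D}(C,W)\to\mathcal{D}(B,W)$$ are exact. For classes of objects $\mathcal{X},\mathcal{Y}$, let $\mathcal{X}\star\mathcal{Y}$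 be the class of objects $C$ that admit an $\mathfrak{s}$-conflation $X\to C\to Y$ with $X\in\mathcal{X}$, $Y\in\mathcal{Y}$. An $s$-torsion pair in $\mathcal{D}$ is a pair $(\mathcal{T},\mathcal{F})$ of full subcategories closed under isomorphisms with $\mathcal{D}(\mathcal{T},\mathcal{F})=0$, $\mathbb{E}^{-1}(\mathcal{T},\mathcal{F})=0$ and $\mathcal{D}=\mathcal{T}\star\mathcal{F}$. The $s$-torsion pairs form a poset $\mathsf{stors}\,\mathcal{D}$ with $(\mathcal{T},\mathcal{F})\le(\mathcal{T}',\mathcal{F}')$ if and only if $\mathcal{T}\subseteq\mathcal{T}'$. For $\mathbf{r}=(\mathcal{R},\mathcal{M})\le\mathbf{s}=(\mathcal{S},\mathcal{N})$ in $\mathsf{stors}\,\mathcal{D}$, let $[\mathbf{r},\mathbf{s}]$ be the interval in $\mathsf{stors}\,\mathcal{D}$ and let $\mathcal{H}_{[\mathbf{r},\mathbf{s}]}:=\mathcal{M}\cap\mathcal{S}$; this full subcategory is closed under extensions and carries the induced structure of an extriangulated category with negative first extension. For $\mathbf{x}\le\mathbf{y}\le\mathbf{z}$ in $\mathsf{stors}\,\mathcal{D}$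 put $$\mathsf{stors}\,\mathcal{H}^{+}_{[\mathbf{x},\mathbf{y},\mathbf{z}]}:=\{(\mathcal{T},\mathcal{F})\in\mathsf{stors}\,\mathcal{H}_{[\mathbf{x},\mathbf{z}]}:\mathcal{T}\subseteq\mathcal{H}_{[\mathbf{x},\mathbf{y}]}\},\qquad \mathsf{stors}\,\mathcal{H}^{-}_{[\mathbf{x},\mathbf{y},\mathbf{z}]}:=\{(\mathcal{T},\mathcal{F})\in\mathsf{stors}\,\mathcal{H}_{[\mathbf{x},\mathbf{z}]}:\mathcal{H}_{[\mathbf{x},\mathbf{y}]}\subseteq\mathcal{T}\}.$$ Theorem 3.16. Let $\mathbf{t}_i=(\mathcal{T}_i,\mathcal{F}_i)\in\mathsf{stors}\,\mathcal{D}$, $i=1,2,3,4$, with $\mathbf{t}_1\le\mathbf{t}_2\le\mathbf{t}_3\le\mathbf{t}_4$. Then: (a) The map $\Phi_r:[\mathbf{t}_2,\mathbf{t}_3]\to\mathsf{stors}\,\mathcal{H}^{+}_{[\mathbf{t}_2,\mathbf{t}_3,\mathbf{t}_4]}$, $(\mathcal{T},\mathcal{F})\mapsto(\mathcal{T}\cap\mathcal{F}_2,\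 \mathcal{T}_4\cap\mathcal{F})$, is well defined and an isomorphism of posets with inverse $(\mathcal{X},\mathcal{Y})\mapsto(\mathcal{T}_2\star\mathcal{X},\ \mathcal{Y}\star\mathcal{F}_4)$. (b) The map $\Phi_\ell:[\mathbf{t}_2,\mathbf{t}_3]\to\mathsf{stors}\,\mathcal{H}^{-}_{[\mathbf{t}_1,\mathbf{t}_2,\mathbf{t}_3]}$, $(\mathcal{T},\mathcal{F})\mapsto(\mathcal{T}\cap\mathcal{F}_1,\ \mathcal{T}_3\cap\mathcal{F})$, is well defined and an isomorphism of posets with inverse $(\mathcal{X},\mathcal{Y})\mapsto(\mathcal{T}_1\star\mathcal{X},\ \mathcal{Y}\star\mathcal{F}_3)$. (c) The map $\varepsilon:\mathsf{stors}\,\mathcal{H}^{+}_{[\mathbf{t}_2,\mathbf{t}_3,\mathbf{t}_4]}\to\mathsf{stors}\,\mathcal{H}^{-}_{[\mathbf{t}_1,\mathbf{t}_2,\mathbf{t}_3]}$, $(\mathcal{X},\mathcal{Y})\mapsto((\mathcal{T}_2\star\mathcal{X})\cap\mathcal{F}_1,\ (\mathcal{Y}\star\mathcal{F}_4)\cap\mathcal{T}_3)$,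 is well defined and an isomorphism of posets with inverse $(\mathcal{T},\mathcal{F})\mapsto((\mathcal{T}_1\star\mathcal{T})\cap\mathcal{F}_2,\ (\mathcal{F}\star\mathcal{F}_3)\cap\mathcal{T}_4)$. -/

import Mathlib

open CategoryTheory CategoryTheory.Limits Opposite
open scoped ZeroObject

universe w w' v u

namespace STorsion

section Bifunctor

variable {C : Type u} [Category.{v} C]

/-- The underlying abelian group `E(Z, A)` of a bifunctor `E : Cᵒᵖ × C → Ab`. -/
abbrev Elt (E : Cᵒᵖ ⥤ C ⥤ AddCommGrpCat.{w}) (Z A : C) : Type w :=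
  ((E.obj (op Z)).obj A : AddCommGrpCat.{w})

/-- `a · δ = E(Z, a)(δ)`. -/
def push (E : Cᵒᵖ ⥤ C ⥤ AddCommGrpCat.{w}) {Z A A' : C} (a : A ⟶ A') :
    Elt E Z A →+ Elt E Z A' :=
  ((E.obj (op Z)).map a).hom

/-- `δ · c = E(c, A)(δ)`. -/
def pull (E : Cᵒᵖ ⥤ C ⥤ AddCommGrpCat.{w}) {Z Z' A : C} (c : Z' ⟶ Z) :
    Elt E Z A →+ Elt E Z' A :=
  ((E.map c.op).app A).hom

variable (E : Cᵒᵖ ⥤ C ⥤ AddCommGrpCat.{w})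

theorem push_id {Z A : C} (δ : Elt E Z A) : push E (𝟙 A) δ = δ := by
  simp [push]

theorem push_comp {Z A A' A'' : C} (a : A ⟶ A') (a' : A' ⟶ A'') (δ : Elt E Z A) :
    push E (a ≫ a') δ = push E a' (push E a δ) := by
  simp [push]

theorem pull_id {Z A : C} (δ : Elt E Z A) : pull E (𝟙 Z) δ = δ := by
  simp [pull]

theorem pull_comp {Z Z' Z'' A : C} (c : Z' ⟶ Z) (c' : Z'' ⟶ Z') (δ : Elt E Z A) :
    pull E (c' ≫ c) δ = pull E c' (pull E c δ) := by
  simp [pull]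

theorem push_pull {Z Z' A A' : C} (a : A ⟶ A') (c : Z' ⟶ Z) (δ : Elt E Z A) :
    push E a (pull E c δ) = pull E c (push E a δ) := by
  have h := (E.map c.op).naturality a
  have h' := congrArg (fun f => f.hom δ) h
  simp only [push, pull]
  exact h'.symm

/-- Additivity of a bifunctor `Cᵒᵖ × C → Ab` in each variable. -/
structure IsBiadditive [Preadditive C] : Prop where
  right : ∀ X : Cᵒᵖ, (E.obj X).Additive
  left : ∀ A : C, (E.flip.obj A).Additive

/-- The direct sum `δ ⊕ δ' ∈ E(Z ⊕ Z', A ⊕ A')`: the element with components `δ, 0, 0, δ'`. -/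
noncomputable def dsum [Preadditive C] [HasBinaryBiproducts C] {Z Z' A A' : C}
    (δ : Elt E Z A) (δ' : Elt E Z' A') : Elt E (Z ⊞ Z') (A ⊞ A') :=
  push E biprod.inl (pull E biprod.fst δ) + push E biprod.inr (pull E biprod.snd δ')

end Bifunctor

/-- An extriangulated structure (in the sense of Nakaoka and Palu) on an additive category `C`.
`Realizes δ x y` says that the sequence `A --x--> B --y--> Z` belongs to the class `𝔰(δ)`. -/
structure Extriangulated (C : Type u) [Category.{v} C] [Preadditive C]
    [HasZeroObject C] [HasBinaryBiproducts C] where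
  E : Cᵒᵖ ⥤ C ⥤ AddCommGrpCat.{w}
  biadditive : IsBiadditive E
  Realizes : ∀ {A B Z : C}, Elt E Z A → (A ⟶ B) → (B ⟶ Z) → Prop
  -- `𝔰(δ)` is an equivalence class of sequences with end terms `A` and `Z`
  exists_realizes : ∀ {A Z : C} (δ : Elt E Z A),
    ∃ (B : C) (x : A ⟶ B) (y : B ⟶ Z), Realizes δ x y
  realizes_iff : ∀ {A B B' Z : C} (δ : Elt E Z A) (x : A ⟶ B) (y : B ⟶ Z)
    (x' : A ⟶ B') (y' : B' ⟶ Z), Realizes δ x y →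
    (Realizes δ x' y' ↔ ∃ e : B ≅ B', x ≫ e.hom = x' ∧ e.hom ≫ y' = y)
  -- morphisms of extensions can be realized
  exists_realizes_hom : ∀ {A B Z A' B' Z' : C} (δ : Elt E Z A) (δ' : Elt E Z' A')
    (x : A ⟶ B) (y : B ⟶ Z) (x' : A' ⟶ B') (y' : B' ⟶ Z'),
    Realizes δ x y → Realizes δ' x' y' →
    ∀ (a : A ⟶ A') (c : Z ⟶ Z'), push E a δ = pull E c δ' →
    ∃ b : B ⟶ B', x ≫ b = a ≫ x' ∧ b ≫ y' = y ≫ c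
  -- additivity of the realization
  realizes_zero : ∀ A Z : C,
    Realizes (0 : Elt E Z A) (biprod.inl : A ⟶ A ⊞ Z) (biprod.snd : A ⊞ Z ⟶ Z)
  realizes_dsum : ∀ {A B Z A' B' Z' : C} (δ : Elt E Z A) (δ' : Elt E Z' A')
    (x : A ⟶ B) (y : B ⟶ Z) (x' : A' ⟶ B') (y' : B' ⟶ Z'),
    Realizes δ x y → Realizes δ' x' y' →
    Realizes (dsum E δ δ') (biprod.map x x') (biprod.map y y')
  -- (ET3)
  et3 : ∀ {A B Z A' B' Z' : C} (δ : Elt E Z A) (δ' : Elt E Z' A')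
    (x : A ⟶ B) (y : B ⟶ Z) (x' : A' ⟶ B') (y' : B' ⟶ Z'),
    Realizes δ x y → Realizes δ' x' y' →
    ∀ (a : A ⟶ A') (b : B ⟶ B'), x ≫ b = a ≫ x' →
    ∃ c : Z ⟶ Z', b ≫ y' = y ≫ c ∧ push E a δ = pull E c δ'
  -- (ET3)ᵒᵖ
  et3_op : ∀ {A B Z A' B' Z' : C} (δ : Elt E Z A) (δ' : Elt E Z' A')
    (x : A ⟶ B) (y : B ⟶ Z) (x' : A' ⟶ B') (y' : B' ⟶ Z'),
    Realizes δ x y → Realizes δ' x' y' →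
    ∀ (b : B ⟶ B') (c : Z ⟶ Z'), b ≫ y' = y ≫ c →
    ∃ a : A ⟶ A', x ≫ b = a ≫ x' ∧ push E a δ = pull E c δ'
  -- (ET4)
  et4 : ∀ {A B X D F : C} (δ : Elt E D A) (δ' : Elt E F B)
    (f : A ⟶ B) (f' : B ⟶ D) (g : B ⟶ X) (g' : X ⟶ F),
    Realizes δ f f' → Realizes δ' g g' →
    ∃ (G : C) (h' : X ⟶ G) (d : D ⟶ G) (e : G ⟶ F) (δ'' : Elt E G A),
      Realizes δ'' (f ≫ g) h' ∧ f' ≫ d = g ≫ h' ∧ h' ≫ e = g' ∧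
      Realizes (push E f' δ') d e ∧ pull E d δ'' = δ ∧ push E f δ'' = pull E e δ'
  -- (ET4)ᵒᵖ
  et4_op : ∀ {A B X D F : C} (δ : Elt E B D) (δ' : Elt E X F)
    (f' : D ⟶ A) (f : A ⟶ B) (g' : F ⟶ B) (g : B ⟶ X),
    Realizes δ f' f → Realizes δ' g' g →
    ∃ (G : C) (h' : G ⟶ A) (d : D ⟶ G) (e : G ⟶ F) (δ'' : Elt E X G),
      Realizes δ'' h' (f ≫ g) ∧ d ≫ h' = f' ∧ e ≫ g' = h' ≫ f ∧
      Realizes (pull E g' δ) d e ∧ push E e δ'' = δ' ∧ push E d δ = pull E g δ''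

/-- An extriangulated category with negative first extension. `N` is the bifunctor `E⁻¹`; for
`δ ∈ E(Z, A)`, `dl δ` and `dr δ` are the natural transformations `E⁻¹(-, Z) → C(-, A)` and
`E⁻¹(A, -) → C(Z, -)`. -/
structure NegExtriangulated (C : Type u) [Category.{v} C] [Preadditive C]
    [HasZeroObject C] [HasBinaryBiproducts C] extends Extriangulated.{w} C where
  N : Cᵒᵖ ⥤ C ⥤ AddCommGrpCat.{w'}
  N_biadditive : IsBiadditive N
  dl : ∀ {A Z : C} (_ : Elt E Z A) (W : C), Elt N W Z →+ (W ⟶ A)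
  dl_naturality : ∀ {A Z : C} (δ : Elt E Z A) {W W' : C} (f : W' ⟶ W) (n : Elt N W Z),
    dl δ W' (pull N f n) = f ≫ dl δ W n
  dr : ∀ {A Z : C} (_ : Elt E Z A) (W : C), Elt N A W →+ (Z ⟶ W)
  dr_naturality : ∀ {A Z : C} (δ : Elt E Z A) {W W' : C} (f : W ⟶ W') (n : Elt N A W),
    dr δ W' (push N f n) = dr δ W n ≫ f
  exact_left : ∀ {A B Z : C} (δ : Elt E Z A) (x : A ⟶ B) (y : B ⟶ Z), Realizes δ x y →
    ∀ W : C,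
      Function.Exact (push N x : Elt N W A → Elt N W B) (push N y : Elt N W B → Elt N W Z) ∧
      Function.Exact (push N y : Elt N W B → Elt N W Z) (dl δ W) ∧
      Function.Exact (dl δ W) (fun f : W ⟶ A => f ≫ x)
  exact_right : ∀ {A B Z : C} (δ : Elt E Z A) (x : A ⟶ B) (y : B ⟶ Z), Realizes δ x y →
    ∀ W : C,
      Function.Exact (pull N y : Elt N Z W → Elt N B W) (pull N x : Elt N B W → Elt N A W) ∧
      Function.Exact (pull N x : Elt N B W → Elt N A W) (dr δ W) ∧
      Function.Exact (dr δ W) (fun f : Z ⟶ W => y ≫ f)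

section Basic

variable {C : Type u} [Category.{v} C] [Preadditive C] [HasZeroObject C] [HasBinaryBiproducts C]

/-- `X ⋆ Y`: the objects `B` admitting an `𝔰`-conflation `A ⟶ B ⟶ Z` with `A ∈ X`, `Z ∈ Y`. -/
def Extriangulated.star (𝓔 : Extriangulated.{w} C) (X Y : ObjectProperty C) :
    ObjectProperty C :=
  fun B => ∃ (A Z : C) (δ : Elt 𝓔.E Z A) (x : A ⟶ B) (y : B ⟶ Z),
    X A ∧ Y Z ∧ 𝓔.Realizes δ x y

/-- `X` is closed under extensions. -/
def Extriangulated.ExtClosed (𝓔 : Extriangulated.{w} C) (X : ObjectProperty C) : Prop :=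
  𝓔.star X X ≤ X

/-- An `s`-torsion pair. -/
@[ext]
structure STors (𝓔 : NegExtriangulated.{w, w'} C) where
  T : ObjectProperty C
  F : ObjectProperty C
  T_iso : T.IsClosedUnderIsomorphisms
  F_iso : F.IsClosedUnderIsomorphisms
  hom_zero : ∀ {X Y : C}, T X → F Y → ∀ f : X ⟶ Y, f = 0
  star_eq : 𝓔.star T F = ⊤
  neg_zero : ∀ {X Y : C}, T X → F Y → ∀ n : Elt 𝓔.N X Y, n = 0

namespace Extriangulated

variable (𝓔 : Extriangulated.{w} C)

theorem realizes_left (A Z : C) (hZ : IsZero Z) :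
    𝓔.Realizes (0 : Elt 𝓔.E Z A) (𝟙 A) (0 : A ⟶ Z) := by
  refine (𝓔.realizes_iff _ _ _ _ _ (𝓔.realizes_zero A Z)).2
    ⟨⟨biprod.fst, biprod.inl, ?_, ?_⟩, ?_, ?_⟩
  · ext
    · simp
    · simp
    · exact hZ.eq_of_src _ _
    · exact hZ.eq_of_tgt _ _
  · simp
  · simp
  · exact hZ.eq_of_tgt _ _

theorem realizes_right (A Z : C) (hA : IsZero A) :
    𝓔.Realizes (0 : Elt 𝓔.E Z A) (0 : A ⟶ Z) (𝟙 Z) := by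
  refine (𝓔.realizes_iff _ _ _ _ _ (𝓔.realizes_zero A Z)).2
    ⟨⟨biprod.snd, biprod.inr, ?_, ?_⟩, ?_, ?_⟩
  · ext
    · exact hA.eq_of_tgt _ _
    · exact hA.eq_of_src _ _
    · exact hA.eq_of_tgt _ _
    · simp
  · simp
  · exact hA.eq_of_src _ _
  · simp

variable {𝓔} {A B Z : C} {δ : Elt 𝓔.E Z A} {x : A ⟶ B} {y : B ⟶ Z}

theorem Realizes.comp_zero (h : 𝓔.Realizes δ x y) : x ≫ y = 0 := by
  obtain ⟨c, hc, -⟩ := 𝓔.et3 _ _ _ _ _ _ (𝓔.realizes_left A 0 (isZero_zero C)) h (𝟙 A) x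
    (by simp)
  simpa using hc

theorem Realizes.lift (h : 𝓔.Realizes δ x y) {W : C} (f : W ⟶ B) (hf : f ≫ y = 0) :
    ∃ g : W ⟶ A, g ≫ x = f := by
  obtain ⟨a, ha, -⟩ := 𝓔.et3_op _ _ _ _ _ _ (𝓔.realizes_left W 0 (isZero_zero C)) h f 0
    (by simpa using hf)
  exact ⟨a, by simpa using ha.symm⟩

theorem Realizes.desc (h : 𝓔.Realizes δ x y) {W : C} (f : B ⟶ W) (hf : x ≫ f = 0) :
    ∃ g : Z ⟶ W, y ≫ g = f := by
  obtain ⟨c, hc, -⟩ := 𝓔.et3 _ _ _ _ _ _ h (𝓔.realizes_right 0 W (isZero_zero C)) 0 f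
    (by simpa using hf)
  exact ⟨c, by simpa using hc.symm⟩

theorem Realizes.pull_zero (h : 𝓔.Realizes δ x y) : pull 𝓔.E y δ = 0 := by
  obtain ⟨c, hc, h'⟩ := 𝓔.et3 _ _ _ _ _ _ (𝓔.realizes_right 0 B (isZero_zero C)) h 0 (𝟙 B)
    (by simp)
  have hc' : y = c := by simpa using hc
  rw [hc', ← h', map_zero]

theorem Realizes.push_zero (h : 𝓔.Realizes δ x y) : push 𝓔.E x δ = 0 := by
  obtain ⟨a, ha, h'⟩ := 𝓔.et3_op _ _ _ _ _ _ h (𝓔.realizes_left B 0 (isZero_zero C)) (𝟙 B) 0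
    (by simp)
  have ha' : x = a := by simpa using ha
  rw [ha', h', map_zero]

theorem Realizes.lift_of_pull (h : 𝓔.Realizes δ x y) {W : C} (f : W ⟶ Z)
    (hf : pull 𝓔.E f δ = 0) : ∃ g : W ⟶ B, g ≫ y = f := by
  obtain ⟨b, -, hb⟩ := 𝓔.exists_realizes_hom _ _ _ _ _ _ (𝓔.realizes_zero A W) h (𝟙 A) f
    (by rw [hf, map_zero])
  exact ⟨biprod.inr ≫ b, by simp [hb]⟩

theorem Realizes.desc_of_push (h : 𝓔.Realizes δ x y) {W : C} (f : A ⟶ W)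
    (hf : push 𝓔.E f δ = 0) : ∃ g : B ⟶ W, x ≫ g = f := by
  obtain ⟨b, hb, -⟩ := 𝓔.exists_realizes_hom _ _ _ _ _ _ h (𝓔.realizes_zero W Z) f (𝟙 Z)
    (by rw [hf, map_zero])
  exact ⟨b ≫ biprod.fst, by rw [← Category.assoc, hb]; simp⟩

theorem Realizes.of_iso (h : 𝓔.Realizes δ x y) {A' Z' : C} (a : A ≅ A') (c : Z ≅ Z') :
    𝓔.Realizes (push 𝓔.E a.hom (pull 𝓔.E c.inv δ)) (a.inv ≫ x) (y ≫ c.hom) := by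
  obtain ⟨B', x', y', h'⟩ := 𝓔.exists_realizes (push 𝓔.E a.hom (pull 𝓔.E c.inv δ))
  have hpull : pull 𝓔.E c.hom (push 𝓔.E a.hom (pull 𝓔.E c.inv δ)) = push 𝓔.E a.hom δ := by
    rw [← push_pull, ← pull_comp]; simp [pull_id]
  obtain ⟨b, hb₁, hb₂⟩ := 𝓔.exists_realizes_hom _ _ _ _ _ _ h h' a.hom c.hom hpull.symm
  -- `b` is a split epimorphism
  have hepi : ∃ s : B' ⟶ B, s ≫ b = 𝟙 B' := by
    obtain ⟨g, hg⟩ := h.lift_of_pull (y' ≫ c.inv) (by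
      have h0 := h'.pull_zero
      rw [← push_pull, ← pull_comp] at h0
      have h1 := congrArg (push 𝓔.E a.inv) h0
      rw [← push_comp, a.hom_inv_id, push_id, map_zero] at h1
      exact h1)
    obtain ⟨k, hk⟩ := h'.lift (𝟙 B' - g ≫ b) (by
      rw [Preadditive.sub_comp, Category.assoc, hb₂, ← Category.assoc, hg]; simp)
    refine ⟨g + k ≫ a.inv ≫ x, ?_⟩
    rw [Preadditive.add_comp, Category.assoc, Category.assoc, hb₁, a.inv_hom_id_assoc, hk]
    abel
  have hmono : ∃ r : B' ⟶ B, b ≫ r = 𝟙 B := by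
    obtain ⟨g, hg⟩ := h'.desc_of_push (a.inv ≫ x) (by
      have h0 := h.push_zero
      rw [push_comp, ← push_comp, ← push_comp, a.hom_inv_id_assoc, push_pull, h0, map_zero])
    obtain ⟨k, hk⟩ := h.desc (𝟙 B - b ≫ g) (by
      rw [Preadditive.comp_sub, ← Category.assoc, hb₁, Category.assoc, hg]; simp)
    refine ⟨g + y' ≫ c.inv ≫ k, ?_⟩
    rw [Preadditive.comp_add, ← Category.assoc b y', hb₂, Category.assoc, c.hom_inv_id_assoc, hk]
    abel
  obtain ⟨s, hs⟩ := hepi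
  obtain ⟨r, hr⟩ := hmono
  have hsr : s = r := by
    calc s = s ≫ b ≫ r := by rw [hr, Category.comp_id]
      _ = r := by rw [← Category.assoc, hs, Category.id_comp]
  subst hsr
  refine (𝓔.realizes_iff _ _ _ _ _ h').2 ⟨⟨s, b, hs, hr⟩, ?_, ?_⟩
  · have : x' = a.inv ≫ x ≫ b := by rw [hb₁, a.inv_hom_id_assoc]
    change x' ≫ s = _
    rw [this, Category.assoc, Category.assoc, hr, Category.comp_id]
  · change s ≫ y ≫ c.hom = y'
    rw [← hb₂, ← Category.assoc, hs, Category.id_comp]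

end Extriangulated

end Basic

section Restriction

/-- The restriction of a bifunctor to a full subcategory. -/
abbrev restrictBifunctor {C : Type u} [Category.{v} C] (E : Cᵒᵖ ⥤ C ⥤ AddCommGrpCat.{w}) (P : ObjectProperty C) :
    P.FullSubcategoryᵒᵖ ⥤ P.FullSubcategory ⥤ AddCommGrpCat.{w} :=
  P.ι.op ⋙ E ⋙ (Functor.whiskeringLeft _ _ _).obj P.ι

theorem IsBiadditive.restrict {C : Type u} [Category.{v} C] [Preadditive C] {E : Cᵒᵖ ⥤ C ⥤ AddCommGrpCat.{w}}
    (h : IsBiadditive E) (P : ObjectProperty C) : IsBiadditive (restrictBifunctor E P) where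
  right X := by
    have := h.right (P.ι.op.obj X)
    exact inferInstanceAs (P.ι ⋙ E.obj (P.ι.op.obj X)).Additive
  left A := by
    have := h.left A.obj
    exact inferInstanceAs (P.ι.op ⋙ E.flip.obj A.obj).Additive

section

variable {C : Type u} [Category.{v} C] [Preadditive C] [HasBinaryBiproducts C]

/-- Direct sums in a full subcategory are direct sums in `C`. -/
noncomputable def biprodObjIso {P : ObjectProperty C} [HasBinaryBiproducts P.FullSubcategory]
    (A B : P.FullSubcategory) : A.obj ⊞ B.obj ≅ (A ⊞ B).obj where
  hom := biprod.desc (biprod.inl : A ⟶ A ⊞ B).hom (biprod.inr : B ⟶ A ⊞ B).hom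
  inv := biprod.lift (biprod.fst : A ⊞ B ⟶ A).hom (biprod.snd : A ⊞ B ⟶ B).hom
  hom_inv_id := by
    ext <;> simp [← ObjectProperty.FullSubcategory.comp_hom]
  inv_hom_id := by
    rw [biprod.lift_desc]
    exact congrArg (fun f => f.hom) (biprod.total (X := A) (Y := B))

variable {P : ObjectProperty C} [HasBinaryBiproducts P.FullSubcategory] (A B : P.FullSubcategory)

theorem inl_biprodObjIso_hom :
    biprod.inl ≫ (biprodObjIso A B).hom = (biprod.inl : A ⟶ A ⊞ B).hom := by
  simp [biprodObjIso]

theorem inr_biprodObjIso_hom :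
    biprod.inr ≫ (biprodObjIso A B).hom = (biprod.inr : B ⟶ A ⊞ B).hom := by
  simp [biprodObjIso]

theorem biprodObjIso_inv_fst :
    (biprodObjIso A B).inv ≫ biprod.fst = (biprod.fst : A ⊞ B ⟶ A).hom := by
  simp [biprodObjIso]

theorem biprodObjIso_inv_snd :
    (biprodObjIso A B).inv ≫ biprod.snd = (biprod.snd : A ⊞ B ⟶ B).hom := by
  simp [biprodObjIso]

end

variable {C : Type u} [Category.{v} C] [Preadditive C] [HasZeroObject C] [HasBinaryBiproducts C]

/-- A full subcategory closed under extensions has direct sums. -/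
theorem Extriangulated.hasBinaryBiproducts (𝓔 : Extriangulated.{w} C) (P : ObjectProperty C)
    (hiso : P.IsClosedUnderIsomorphisms) (hP : 𝓔.ExtClosed P) :
    HasBinaryBiproducts P.FullSubcategory := by
  have : P.IsClosedUnderBinaryProducts := ⟨by
    rintro X ⟨p⟩
    refine hiso.of_iso (IsLimit.conePointsIsoOfNatIso (BinaryBiproduct.isLimit _ _) p.isLimit
      (diagramIsoPair p.diag).symm) ?_
    exact hP _ ⟨_, _, _, _, _, p.prop_diag_obj ⟨.left⟩, p.prop_diag_obj ⟨.right⟩,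
      𝓔.realizes_zero _ _⟩⟩
  have : HasBinaryProducts P.FullSubcategory := by
    unfold HasBinaryProducts; infer_instance
  exact HasBinaryBiproducts.of_hasBinaryProducts

/-- The extriangulated structure induced on a full subcategory closed under extensions: the
extensions and the conflations are those of `C` whose three terms are in the subcategory. -/
def Extriangulated.restrict (𝓔 : Extriangulated.{w} C) (P : ObjectProperty C)
    [HasZeroObject P.FullSubcategory] [HasBinaryBiproducts P.FullSubcategory]
    (hP : 𝓔.ExtClosed P) : Extriangulated.{w} P.FullSubcategory where
  E := restrictBifunctor 𝓔.E P
  biadditive := 𝓔.biadditive.restrict P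
  Realizes {A B Z} δ x y :=
    𝓔.Realizes (A := A.obj) (B := B.obj) (Z := Z.obj) δ x.hom y.hom
  exists_realizes {A Z} δ := by
    obtain ⟨B, x, y, h⟩ := 𝓔.exists_realizes (A := A.obj) (Z := Z.obj) δ
    have hB : P B := hP _ ⟨_, _, _, _, _, A.property, Z.property, h⟩
    exact ⟨⟨B, hB⟩, ObjectProperty.homMk x, ObjectProperty.homMk y, h⟩
  realizes_iff {A B B' Z} δ x y x' y' h := by
    refine (𝓔.realizes_iff (A := A.obj) (Z := Z.obj) δ x.hom y.hom x'.hom y'.hom h).trans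
      ⟨?_, ?_⟩
    · rintro ⟨e, h₁, h₂⟩
      exact ⟨P.isoMk e, ObjectProperty.hom_ext _ h₁, ObjectProperty.hom_ext _ h₂⟩
    · rintro ⟨e, h₁, h₂⟩
      exact ⟨P.ι.mapIso e, congrArg (fun f => f.hom) h₁, congrArg (fun f => f.hom) h₂⟩
  exists_realizes_hom {A B Z A' B' Z'} δ δ' x y x' y' h h' a c hac := by
    obtain ⟨b, h₁, h₂⟩ := 𝓔.exists_realizes_hom (A := A.obj) (Z := Z.obj) (A' := A'.obj)
      (Z' := Z'.obj) δ δ' _ _ _ _ h h' a.hom c.hom hac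
    exact ⟨ObjectProperty.homMk b, ObjectProperty.hom_ext _ h₁, ObjectProperty.hom_ext _ h₂⟩
  realizes_zero A Z := by
    refine (𝓔.realizes_iff _ _ _ _ _ (𝓔.realizes_zero A.obj Z.obj)).2
      ⟨biprodObjIso A Z, ?_, ?_⟩
    · exact inl_biprodObjIso_hom A Z
    · ext1
      · rw [← Category.assoc, inl_biprodObjIso_hom, biprod.inl_snd]
        exact congrArg (fun f => f.hom) (biprod.inl_snd (X := A) (Y := Z))
      · rw [← Category.assoc, inr_biprodObjIso_hom, biprod.inr_snd]
        exact congrArg (fun f => f.hom) (biprod.inr_snd (X := A) (Y := Z))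
  realizes_dsum {A B Z A' B' Z'} δ δ' x y x' y' h h' := by
    have key := (𝓔.realizes_dsum (A := A.obj) (B := B.obj) (Z := Z.obj) (A' := A'.obj)
      (B' := B'.obj) (Z' := Z'.obj) δ δ' _ _ _ _ h h').of_iso
      (biprodObjIso A A') (biprodObjIso Z Z')
    have e : push 𝓔.E (biprodObjIso A A').hom (pull 𝓔.E (biprodObjIso Z Z').inv
        (dsum 𝓔.E (Z := Z.obj) (A := A.obj) (Z' := Z'.obj) (A' := A'.obj) δ δ')) =
        dsum (restrictBifunctor 𝓔.E P) δ δ' := by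
      simp only [dsum, map_add, push_pull, ← push_comp, ← pull_comp]
      rw [inl_biprodObjIso_hom, inr_biprodObjIso_hom, biprodObjIso_inv_fst,
        biprodObjIso_inv_snd]
      rfl
    rw [e] at key
    refine (𝓔.realizes_iff _ _ _ _ _ key).2 ⟨biprodObjIso B B', ?_, ?_⟩
    · rw [Category.assoc, Iso.inv_comp_eq]
      ext1
      · rw [biprod.inl_map_assoc, inl_biprodObjIso_hom, ← Category.assoc, inl_biprodObjIso_hom]
        exact congrArg (fun f => f.hom) (biprod.inl_map x x').symm
      · rw [biprod.inr_map_assoc, inr_biprodObjIso_hom, ← Category.assoc, inr_biprodObjIso_hom]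
        exact congrArg (fun f => f.hom) (biprod.inr_map x x').symm
    · ext1
      · rw [biprod.inl_map_assoc, inl_biprodObjIso_hom, ← Category.assoc, inl_biprodObjIso_hom]
        exact congrArg (fun f => f.hom) (biprod.inl_map y y')
      · rw [biprod.inr_map_assoc, inr_biprodObjIso_hom, ← Category.assoc, inr_biprodObjIso_hom]
        exact congrArg (fun f => f.hom) (biprod.inr_map y y')
  et3 {A B Z A' B' Z'} δ δ' x y x' y' h h' a b hab := by
    obtain ⟨c, h₁, h₂⟩ := 𝓔.et3 (A := A.obj) (Z := Z.obj) (A' := A'.obj)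
      (Z' := Z'.obj) δ δ' _ _ _ _ h h' a.hom b.hom (congrArg (fun f => f.hom) hab)
    exact ⟨ObjectProperty.homMk c, ObjectProperty.hom_ext _ h₁, h₂⟩
  et3_op {A B Z A' B' Z'} δ δ' x y x' y' h h' b c hbc := by
    obtain ⟨a, h₁, h₂⟩ := 𝓔.et3_op (A := A.obj) (Z := Z.obj) (A' := A'.obj)
      (Z' := Z'.obj) δ δ' _ _ _ _ h h' b.hom c.hom (congrArg (fun f => f.hom) hbc)
    exact ⟨ObjectProperty.homMk a, ObjectProperty.hom_ext _ h₁, h₂⟩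
  et4 {A B X D F} δ δ' f f' g g' h h' := by
    obtain ⟨G, k, d, e, δ'', h₁, h₂, h₃, h₄, h₅, h₆⟩ := 𝓔.et4 (A := A.obj) (B := B.obj)
      (X := X.obj) (D := D.obj) (F := F.obj) δ δ' _ _ _ _ h h'
    have hG : P G := hP _ ⟨_, _, _, _, _, D.property, F.property, h₄⟩
    exact ⟨⟨G, hG⟩, ObjectProperty.homMk k, ObjectProperty.homMk d, ObjectProperty.homMk e, δ'',
      h₁, ObjectProperty.hom_ext _ h₂, ObjectProperty.hom_ext _ h₃, h₄, h₅, h₆⟩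
  et4_op {A B X D F} δ δ' f' f g' g h h' := by
    obtain ⟨G, k, d, e, δ'', h₁, h₂, h₃, h₄, h₅, h₆⟩ := 𝓔.et4_op (A := A.obj) (B := B.obj)
      (X := X.obj) (D := D.obj) (F := F.obj) δ δ' _ _ _ _ h h'
    have hG : P G := hP _ ⟨_, _, _, _, _, D.property, F.property, h₄⟩
    exact ⟨⟨G, hG⟩, ObjectProperty.homMk k, ObjectProperty.homMk d, ObjectProperty.homMk e, δ'',
      h₁, ObjectProperty.hom_ext _ h₂, ObjectProperty.hom_ext _ h₃, h₄, h₅, h₆⟩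

/-- The induced structure of an extriangulated category with negative first extension on a full
subcategory closed under extensions. -/
def NegExtriangulated.restrict (𝓔 : NegExtriangulated.{w, w'} C) (P : ObjectProperty C)
    [HasZeroObject P.FullSubcategory] [HasBinaryBiproducts P.FullSubcategory]
    (hP : 𝓔.ExtClosed P) : NegExtriangulated.{w, w'} P.FullSubcategory where
  toExtriangulated := 𝓔.toExtriangulated.restrict P hP
  N := restrictBifunctor 𝓔.N P
  N_biadditive := 𝓔.N_biadditive.restrict P
  dl {A Z} δ W :=
    { toFun := fun n => ObjectProperty.homMk (𝓔.dl (A := A.obj) (Z := Z.obj) δ W.obj n)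
      map_zero' := ObjectProperty.hom_ext _ (map_zero (𝓔.dl (A := A.obj) (Z := Z.obj) δ W.obj))
      map_add' := fun n n' => ObjectProperty.hom_ext _
        (map_add (𝓔.dl (A := A.obj) (Z := Z.obj) δ W.obj) n n') }
  dl_naturality {A Z} δ W W' f n := ObjectProperty.hom_ext _
    (𝓔.dl_naturality (A := A.obj) (Z := Z.obj) δ f.hom n)
  dr {A Z} δ W :=
    { toFun := fun n => ObjectProperty.homMk (𝓔.dr (A := A.obj) (Z := Z.obj) δ W.obj n)
      map_zero' := ObjectProperty.hom_ext _ (map_zero (𝓔.dr (A := A.obj) (Z := Z.obj) δ W.obj))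
      map_add' := fun n n' => ObjectProperty.hom_ext _
        (map_add (𝓔.dr (A := A.obj) (Z := Z.obj) δ W.obj) n n') }
  dr_naturality {A Z} δ W W' f n := ObjectProperty.hom_ext _
    (𝓔.dr_naturality (A := A.obj) (Z := Z.obj) δ f.hom n)
  exact_left {A B Z} δ x y h W := by
    obtain ⟨h₁, h₂, h₃⟩ := 𝓔.exact_left (A := A.obj) (Z := Z.obj) δ _ _ h W.obj
    refine ⟨h₁, fun n => ?_, fun f => ?_⟩
    · exact Iff.trans ⟨fun hn => congrArg (fun f => f.hom) hn,
        fun hn => ObjectProperty.hom_ext _ hn⟩ (h₂ n)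
    · refine Iff.trans ⟨fun hn => congrArg (fun f => f.hom) hn,
        fun hn => ObjectProperty.hom_ext _ hn⟩ ((h₃ f.hom).trans ⟨?_, ?_⟩)
      · rintro ⟨n, hn⟩
        exact ⟨n, ObjectProperty.hom_ext _ hn⟩
      · rintro ⟨n, hn⟩
        exact ⟨n, congrArg (fun f => f.hom) hn⟩
  exact_right {A B Z} δ x y h W := by
    obtain ⟨h₁, h₂, h₃⟩ := 𝓔.exact_right (A := A.obj) (Z := Z.obj) δ _ _ h W.obj
    refine ⟨h₁, fun n => ?_, fun f => ?_⟩
    · exact Iff.trans ⟨fun hn => congrArg (fun f => f.hom) hn,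
        fun hn => ObjectProperty.hom_ext _ hn⟩ (h₂ n)
    · refine Iff.trans ⟨fun hn => congrArg (fun f => f.hom) hn,
        fun hn => ObjectProperty.hom_ext _ hn⟩ ((h₃ f.hom).trans ⟨?_, ?_⟩)
      · rintro ⟨n, hn⟩
        exact ⟨n, ObjectProperty.hom_ext _ hn⟩
      · rintro ⟨n, hn⟩
        exact ⟨n, congrArg (fun f => f.hom) hn⟩

end Restriction

section Poset

variable {C : Type u} [Category.{v} C] [Preadditive C] [HasZeroObject C] [HasBinaryBiproducts C]

namespace STors

variable {𝓔 : NegExtriangulated.{w, w'} C} (t : STors 𝓔)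

theorem exists_conflation (X : C) : ∃ (A Z : C) (δ : Elt 𝓔.E Z A) (x : A ⟶ X) (y : X ⟶ Z),
    t.T A ∧ t.F Z ∧ 𝓔.Realizes δ x y := by
  have h : 𝓔.star t.T t.F X := by rw [t.star_eq]; trivial
  exact h

theorem T_iff (X : C) : t.T X ↔ ∀ (Y : C) (_ : t.F Y) (f : X ⟶ Y), f = 0 := by
  refine ⟨fun hX Y hY f => t.hom_zero hX hY f, fun h => ?_⟩
  obtain ⟨A, Z, δ, x, y, hA, hZ, hr⟩ := t.exists_conflation X
  obtain ⟨s, hs⟩ := hr.lift (𝟙 X) (by rw [h Z hZ y, comp_zero])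
  have h0 : x ≫ s - 𝟙 A = 0 := by
    obtain ⟨n, hn⟩ := ((𝓔.exact_left δ x y hr A).2.2 (x ≫ s - 𝟙 A)).1 (by
      simp [Preadditive.sub_comp, hs])
    rw [← hn, t.neg_zero hA hZ n, map_zero]
  exact t.T_iso.of_iso ⟨x, s, sub_eq_zero.1 h0, hs⟩ hA

theorem F_iff (Y : C) : t.F Y ↔ ∀ (X : C) (_ : t.T X) (f : X ⟶ Y), f = 0 := by
  refine ⟨fun hY X hX f => t.hom_zero hX hY f, fun h => ?_⟩
  obtain ⟨A, Z, δ, x, y, hA, hZ, hr⟩ := t.exists_conflation Y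
  obtain ⟨s, hs⟩ := hr.desc (𝟙 Y) (by rw [h A hA x, zero_comp])
  have h0 : s ≫ y - 𝟙 Z = 0 := by
    obtain ⟨n, hn⟩ := ((𝓔.exact_right δ x y hr Z).2.2 (s ≫ y - 𝟙 Z)).1 (by
      simp only [Preadditive.comp_sub, ← Category.assoc, hs]; simp)
    rw [← hn, t.neg_zero hA hZ n, map_zero]
  exact t.F_iso.of_iso ⟨s, y, sub_eq_zero.1 h0, hs⟩ hZ

theorem T_extClosed : 𝓔.ExtClosed t.T := by
  rintro B ⟨A, Z, δ, x, y, hA, hZ, hr⟩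
  refine (t.T_iff B).2 fun Y hY f => ?_
  obtain ⟨g, rfl⟩ := hr.desc f (t.hom_zero hA hY _)
  rw [t.hom_zero hZ hY g, comp_zero]

theorem F_extClosed : 𝓔.ExtClosed t.F := by
  rintro B ⟨A, Z, δ, x, y, hA, hZ, hr⟩
  refine (t.F_iff B).2 fun X hX f => ?_
  obtain ⟨g, rfl⟩ := hr.lift f (t.hom_zero hX hZ _)
  rw [t.hom_zero hX hA g, zero_comp]

/-- `t ≤ t'` if and only if `T ⊆ T'`. -/
instance : PartialOrder (STors 𝓔) where
  le t t' := t.T ≤ t'.T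
  le_refl t := le_refl t.T
  le_trans _ _ _ h h' := le_trans h h'
  le_antisymm t t' h h' := by
    have hT : t.T = t'.T := le_antisymm h h'
    refine STors.ext hT ?_
    ext Y
    rw [t.F_iff, t'.F_iff, hT]

/-- The heart `H_[r,s] = F_r ∩ T_s` of an interval `[r, s]`. -/
def heart (r s : STors 𝓔) : ObjectProperty C := r.F ⊓ s.T

variable (r s : STors 𝓔)

instance : (heart r s).IsClosedUnderIsomorphisms where
  of_iso e h := ⟨r.F_iso.of_iso e h.1, s.T_iso.of_iso e h.2⟩

instance : (heart r s).ContainsZero where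
  exists_zero := ⟨0, isZero_zero C,
    (r.F_iff 0).2 fun _ _ _ => (isZero_zero C).eq_of_tgt _ _,
    (s.T_iff 0).2 fun _ _ _ => (isZero_zero C).eq_of_src _ _⟩

theorem heart_extClosed : 𝓔.ExtClosed (heart r s) := by
  rintro B ⟨A, Z, δ, x, y, hA, hZ, hr⟩
  exact ⟨r.F_extClosed _ ⟨A, Z, δ, x, y, hA.1, hZ.1, hr⟩,
    s.T_extClosed _ ⟨A, Z, δ, x, y, hA.2, hZ.2, hr⟩⟩

instance : HasBinaryBiproducts (heart r s).FullSubcategory :=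
  𝓔.hasBinaryBiproducts (heart r s) inferInstance (heart_extClosed r s)

/-- The heart `H_[r,s]`, as an extriangulated category with negative first extension. -/
def heartStructure : NegExtriangulated.{w, w'} (heart r s).FullSubcategory :=
  𝓔.restrict (heart r s) (heart_extClosed r s)

/-- A class of objects of a full subcategory, regarded as a class of objects of `C`. -/
def ambient {P : ObjectProperty C} (X : ObjectProperty P.FullSubcategory) : ObjectProperty C :=
  fun A => ∃ h : P A, X ⟨A, h⟩

/-- The `s`-torsion pairs `(T, F)` in `H_[x,z]` such that `T ⊆ H_[x,y]`. -/
def heartPlus (x y z : STors 𝓔) : Set (STors (heartStructure x z)) :=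
  {p | ambient p.T ≤ heart x y}

/-- The `s`-torsion pairs `(T, F)` in `H_[x,z]` such that `H_[x,y] ⊆ T`. -/
def heartMinus (x y z : STors 𝓔) : Set (STors (heartStructure x z)) :=
  {p | heart x y ≤ ambient p.T}

end STors

end Poset

end STorsion

namespace STorsion

/-! For `r ≤ s`, the whole interval `[r, s]` is isomorphic to the poset of `s`-torsion pairs in the
heart `H_[r,s]` (`heartOrderIso`). Parts (a) and (b) restrict this isomorphism to the subinterval
`[t₂, t₃]`, first inside `[t₂, t₄]` and then inside `[t₁, t₃]`; part (c) composes the inverse of the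
first with the second.

From the interval to the heart: take the conflation of an object of `H_[r,s]` with respect to a pair
`t` in `[r, s]`. Its end terms stay in the heart (`F_of_conflation`, `T_of_conflation`); this is
where the vanishing of negative extensions enters.

From the heart to the interval: `⋆` is associative by (ET4) and its dual, and `T_r ⋆ H_[r,s] = T_s`
(`star_T_heart`). Inserting a torsion pair `(X, Y)` of the heart into `T_s ⋆ F_s` therefore splits
the category as `(T_r ⋆ X) ⋆ (Y ⋆ F_s)`, and the vanishing conditions can be checked on the pieces.

The same identity `T_r ⋆ H_[r,t] = T_t` shows that the two constructions are mutually inverse and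
that the order is reflected. Only torsion classes need comparing, since they determine the
torsion-free classes. -/

theorem STors.ambient_le {C : Type u} [Category.{v} C] {P : ObjectProperty C}
    (X : ObjectProperty P.FullSubcategory) : ambient X ≤ P := fun _ h => h.1

section

variable {C : Type u} [Category.{v} C] [Preadditive C] [HasZeroObject C] [HasBinaryBiproducts C]

/-! ### Calculus of `⋆` and vanishing on extensions -/

namespace Extriangulated

variable (𝓔 : Extriangulated.{w} C)

theorem star_mono {X X' Y Y' : ObjectProperty C} (hX : X ≤ X') (hY : Y ≤ Y') :
    𝓔.star X Y ≤ 𝓔.star X' Y' := by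
  rintro B ⟨A, Z, δ, x, y, hA, hZ, h⟩
  exact ⟨A, Z, δ, x, y, hX _ hA, hY _ hZ, h⟩

theorem star_isClosedUnderIsomorphisms (X Y : ObjectProperty C) :
    (𝓔.star X Y).IsClosedUnderIsomorphisms where
  of_iso := by
    rintro B B' e ⟨A, Z, δ, x, y, hA, hZ, h⟩
    exact ⟨A, Z, δ, x ≫ e.hom, e.inv ≫ y, hA, hZ,
      (𝓔.realizes_iff _ _ _ _ _ h).2 ⟨e, rfl, by simp⟩⟩

/-- Each inclusion is one octahedron: (ET4) composes two inflations, and its dual composes two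
deflations. -/
theorem star_assoc (X Y Z : ObjectProperty C) :
    𝓔.star (𝓔.star X Y) Z = 𝓔.star X (𝓔.star Y Z) := by
  apply le_antisymm
  · rintro B ⟨A, F, δ', g, g', ⟨A', D, δ, f, f', hA', hD, h⟩, hF, h'⟩
    obtain ⟨G, k, d, e, δ'', h₁, -, -, h₄, -, -⟩ := 𝓔.et4 _ _ _ _ _ _ h h'
    exact ⟨_, _, _, _, _, hA', ⟨_, _, _, _, _, hD, hF, h₄⟩, h₁⟩
  · rintro B ⟨D, B', δ, f', f, hD, ⟨F, X', δ', g', g, hF, hX', h'⟩, h⟩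
    obtain ⟨G, k, d, e, δ'', h₁, -, -, h₄, -, -⟩ := 𝓔.et4_op _ _ _ _ _ _ h h'
    exact ⟨_, _, _, _, _, ⟨_, _, _, _, _, hD, hF, h₄⟩, hX', h₁⟩

/-- Uses the split conflation `A = A ⟶ 0`; `le_star_right` uses `0 ⟶ A = A`. -/
theorem le_star_left {X Y : ObjectProperty C} (hY : ∃ Z, IsZero Z ∧ Y Z) : X ≤ 𝓔.star X Y := by
  obtain ⟨Z, hZ, hYZ⟩ := hY
  exact fun A hA => ⟨A, Z, _, _, _, hA, hYZ, 𝓔.realizes_left A Z hZ⟩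

theorem le_star_right {X Y : ObjectProperty C} (hX : ∃ Z, IsZero Z ∧ X Z) : Y ≤ 𝓔.star X Y := by
  obtain ⟨Z, hZ, hXZ⟩ := hX
  exact fun A hA => ⟨Z, A, _, _, _, hXZ, hA, 𝓔.realizes_right Z A hZ⟩

/-- A morphism that vanishes on the first term of a conflation factors through the last one. -/
theorem hom_eq_zero_of_star_left {X Y : ObjectProperty C} {B W : C} (hB : 𝓔.star X Y B)
    (hX : ∀ A, X A → ∀ f : A ⟶ W, f = 0) (hY : ∀ A, Y A → ∀ f : A ⟶ W, f = 0) (f : B ⟶ W) :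
    f = 0 := by
  obtain ⟨A, Z, δ, x, y, hA, hZ, h⟩ := hB
  obtain ⟨g, rfl⟩ := h.desc f (hX _ hA _)
  rw [hY _ hZ g, comp_zero]

theorem hom_eq_zero_of_star_right {X Y : ObjectProperty C} {B W : C} (hB : 𝓔.star X Y B)
    (hX : ∀ A, X A → ∀ f : W ⟶ A, f = 0) (hY : ∀ A, Y A → ∀ f : W ⟶ A, f = 0) (f : W ⟶ B) :
    f = 0 := by
  obtain ⟨A, Z, δ, x, y, hA, hZ, h⟩ := hB
  obtain ⟨g, rfl⟩ := h.lift f (hY _ hZ _)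
  rw [hX _ hA g, zero_comp]

end Extriangulated

namespace NegExtriangulated

variable (𝓔 : NegExtriangulated.{w, w'} C)

/-- Exactness of `E⁻¹(-, W)` at the middle term of a conflation replaces the factorization argument
for morphisms. -/
theorem neg_eq_zero_of_star_left {X Y : ObjectProperty C} {B W : C} (hB : 𝓔.star X Y B)
    (hX : ∀ A, X A → ∀ n : Elt 𝓔.N A W, n = 0) (hY : ∀ A, Y A → ∀ n : Elt 𝓔.N A W, n = 0)
    (n : Elt 𝓔.N B W) : n = 0 := by
  obtain ⟨A, Z, δ, x, y, hA, hZ, h⟩ := hB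
  obtain ⟨m, rfl⟩ := ((𝓔.exact_right δ x y h W).1 n).1 (hX _ hA _)
  rw [hY _ hZ m, map_zero]

theorem neg_eq_zero_of_star_right {X Y : ObjectProperty C} {B W : C} (hB : 𝓔.star X Y B)
    (hX : ∀ A, X A → ∀ n : Elt 𝓔.N W A, n = 0) (hY : ∀ A, Y A → ∀ n : Elt 𝓔.N W A, n = 0)
    (n : Elt 𝓔.N W B) : n = 0 := by
  obtain ⟨A, Z, δ, x, y, hA, hZ, h⟩ := hB
  obtain ⟨m, rfl⟩ := ((𝓔.exact_left δ x y h W).1 n).1 (hY _ hZ _)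
  rw [hX _ hA m, map_zero]

end NegExtriangulated

/-! ### Truncation of objects with respect to comparable torsion pairs -/

namespace STors

variable {𝓔 : NegExtriangulated.{w, w'} C}

theorem F_le_of_le {t t' : STors 𝓔} (h : t ≤ t') : t'.F ≤ t.F := fun Y hY =>
  (t.F_iff Y).2 fun _ hX f => t'.hom_zero (h _ hX) hY f

theorem exists_isZero_T (t : STors 𝓔) : ∃ Z, IsZero Z ∧ t.T Z :=
  ⟨0, isZero_zero C, (t.T_iff 0).2 fun _ _ _ => (isZero_zero C).eq_of_src _ _⟩

theorem exists_isZero_F (t : STors 𝓔) : ∃ Z, IsZero Z ∧ t.F Z :=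
  ⟨0, isZero_zero C, (t.F_iff 0).2 fun _ _ _ => (isZero_zero C).eq_of_tgt _ _⟩

/-- The torsion part of an object of `F_r` is in `F_r`. -/
theorem F_of_conflation {r t : STors 𝓔} (hrt : r ≤ t) {A B Z : C} {δ : Elt 𝓔.E Z A} {x : A ⟶ B}
    {y : B ⟶ Z} (h : 𝓔.Realizes δ x y) (hB : r.F B) (hZ : t.F Z) : r.F A :=
  (r.F_iff A).2 fun W hW f => by
    -- The composite `W ⟶ A ⟶ B` vanishes because `W` is in `T_r` and `B` in `F_r`. So `f` comes
    -- from `E⁻¹(W, Z)`, which is zero because `W` also lies in the larger class `t.T`.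
    obtain ⟨n, rfl⟩ := ((𝓔.exact_left δ x y h W).2.2 f).1 (r.hom_zero hW hB _)
    rw [t.neg_zero (hrt _ hW) hZ n, map_zero]

/-- The torsion-free part of an object of `T_s` is in `T_s`. -/
theorem T_of_conflation {t s : STors 𝓔} (hts : t ≤ s) {A B Z : C} {δ : Elt 𝓔.E Z A} {x : A ⟶ B}
    {y : B ⟶ Z} (h : 𝓔.Realizes δ x y) (hB : s.T B) (hA : t.T A) : s.T Z :=
  (s.T_iff Z).2 fun W hW f => by
    obtain ⟨n, rfl⟩ := ((𝓔.exact_right δ x y h W).2.2 f).1 (s.hom_zero hB hW _)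
    rw [t.neg_zero hA (F_le_of_le hts _ hW) n, map_zero]

/-- The `r`-conflation of an object of `T_s` has its torsion-free part again in `T_s`, hence in the
heart. The reverse inclusion is closure of `T_s` under extensions. -/
theorem star_T_heart {r s : STors 𝓔} (hrs : r ≤ s) : 𝓔.star r.T (heart r s) = s.T := by
  apply le_antisymm
  · exact (𝓔.star_mono hrs inf_le_right).trans s.T_extClosed
  · intro B hB
    obtain ⟨A, Z, δ, x, y, hA, hZ, h⟩ := r.exists_conflation B
    exact ⟨A, Z, δ, x, y, hA, ⟨hZ, T_of_conflation hrs h hB hA⟩, h⟩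

/-- Conflations of the heart are, by construction, the conflations of the ambient category with all
terms in the heart. -/
theorem ambient_star {r s : STors 𝓔} (X Y : ObjectProperty (heart r s).FullSubcategory) :
    ambient ((heartStructure r s).star X Y) ≤ 𝓔.star (ambient X) (ambient Y) := by
  rintro B ⟨hB, A, Z, δ, x, y, hA, hZ, h⟩
  exact ⟨A.obj, Z.obj, δ, x.hom, y.hom, ⟨A.property, hA⟩, ⟨Z.property, hZ⟩, h⟩

/-! ### From the interval to the heart -/

/-- The `s`-torsion pair `(T ∩ F_r, T_s ∩ F)` in the heart `H_[r,s]` induced by `(T, F)` in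
`[r, s]`. -/
def toHeart {r s : STors 𝓔} (t : STors 𝓔) (hrt : r ≤ t) (hts : t ≤ s) :
    STors (heartStructure r s) where
  T A := t.T A.obj
  F A := t.F A.obj
  T_iso := ⟨fun e h => t.T_iso.of_iso ((heart r s).ι.mapIso e) h⟩
  F_iso := ⟨fun e h => t.F_iso.of_iso ((heart r s).ι.mapIso e) h⟩
  hom_zero hX hY f := ObjectProperty.hom_ext _ (t.hom_zero hX hY f.hom)
  star_eq := by
    refine top_le_iff.1 fun B _ => ?_
    -- The ambient `t`-conflation already serves: the truncation lemmas place both of its end terms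
    -- in the heart.
    obtain ⟨A, Z, δ, x, y, hA, hZ, h⟩ := t.exists_conflation B.obj
    have hA' : heart r s A := ⟨F_of_conflation hrt h B.property.1 hZ, hts _ hA⟩
    have hZ' : heart r s Z := ⟨F_le_of_le hrt _ hZ, T_of_conflation hts h B.property.2 hA⟩
    exact ⟨⟨A, hA'⟩, ⟨Z, hZ'⟩, δ, ObjectProperty.homMk x, ObjectProperty.homMk y, hA, hZ, h⟩
  neg_zero hX hY n := t.neg_zero hX hY n

/-- Since `t.T` lies in `T_s`, the second condition defining the heart is automatic here; for the
torsion-free class it is the first one, since `t.F` lies in `F_r`. -/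
theorem ambient_toHeart_T {r s t : STors 𝓔} (hrt : r ≤ t) (hts : t ≤ s) :
    ambient (toHeart t hrt hts).T = t.T ⊓ r.F :=
  le_antisymm (fun _ h => ⟨h.2, h.1.1⟩) fun _ h => ⟨⟨h.2, hts _ h.1⟩, h.1⟩

theorem ambient_toHeart_F {r s t : STors 𝓔} (hrt : r ≤ t) (hts : t ≤ s) :
    ambient (toHeart t hrt hts).F = s.T ⊓ t.F :=
  le_antisymm (fun _ h => ⟨h.1.2, h.2⟩) fun _ h => ⟨⟨F_le_of_le hrt _ h.2, h.1⟩, h.2⟩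

/-! ### From the heart to the interval, and the isomorphism of posets -/

section ofHeart

variable {r s : STors 𝓔} (hrs : r ≤ s) (p : STors (heartStructure r s))

theorem heart_le_star_ambient : heart r s ≤ 𝓔.star (ambient p.T) (ambient p.F) := fun B hB =>
  ambient_star p.T p.F B ⟨hB, by rw [p.star_eq]; trivial⟩

theorem ambient_hom_zero {X Y : C} (hX : ambient p.T X) (hY : ambient p.F Y) (f : X ⟶ Y) :
    f = 0 :=
  congrArg (fun g => g.hom) (p.hom_zero hX.2 hY.2 (ObjectProperty.homMk f))

theorem ambient_neg_zero {X Y : C} (hX : ambient p.T X) (hY : ambient p.F Y)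
    (n : Elt 𝓔.N X Y) : n = 0 :=
  p.neg_zero hX.2 hY.2 n

include hrs in
-- Splitting both objects leaves four vanishing statements: `r` handles `T_r` against the heart, `s`
-- handles both pairings with `F_s`, and `p` handles the pairing inside the heart.
theorem star_hom_zero {X Y : C} (hX : 𝓔.star r.T (ambient p.T) X)
    (hY : 𝓔.star (ambient p.F) s.F Y) (f : X ⟶ Y) : f = 0 := by
  refine 𝓔.hom_eq_zero_of_star_left hX (fun A hA g => ?_) (fun A hA g => ?_) f
  · exact 𝓔.hom_eq_zero_of_star_right hY (fun B hB => r.hom_zero hA hB.1.1)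
      (fun B hB => s.hom_zero (hrs _ hA) hB) g
  · exact 𝓔.hom_eq_zero_of_star_right hY (fun B hB => ambient_hom_zero p hA hB)
      (fun B hB => s.hom_zero hA.1.2 hB) g

/-- The `s`-torsion pair `(T_r ⋆ X, Y ⋆ F_s)` obtained from `(X, Y)` in the heart `H_[r,s]`. -/
def ofHeart : STors 𝓔 where
  T := 𝓔.star r.T (ambient p.T)
  F := 𝓔.star (ambient p.F) s.F
  T_iso := 𝓔.star_isClosedUnderIsomorphisms _ _
  F_iso := 𝓔.star_isClosedUnderIsomorphisms _ _
  hom_zero hX hY f := star_hom_zero hrs p hX hY f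
  star_eq := by
    -- Reassociate `(T_r ⋆ X) ⋆ (Y ⋆ F_s)` to `(T_r ⋆ (X ⋆ Y)) ⋆ F_s`. Here `X ⋆ Y` contains the
    -- heart, so the left factor contains `T_r ⋆ H_[r,s] = T_s`.
    rw [← 𝓔.star_assoc, 𝓔.star_assoc r.T]
    refine top_le_iff.1 (s.star_eq.symm.le.trans (𝓔.star_mono ?_ le_rfl))
    rw [← star_T_heart hrs]
    exact 𝓔.star_mono le_rfl (heart_le_star_ambient p)
  neg_zero {X Y} hX hY n := by
    refine 𝓔.neg_eq_zero_of_star_left hX (fun A hA m => ?_) (fun A hA m => ?_) n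
    · exact 𝓔.neg_eq_zero_of_star_right hY (fun B hB => r.neg_zero hA hB.1.1)
        (fun B hB => s.neg_zero (hrs _ hA) hB) m
    · exact 𝓔.neg_eq_zero_of_star_right hY (fun B hB => ambient_neg_zero p hA hB)
        (fun B hB => s.neg_zero hA.1.2 hB) m

theorem le_ofHeart : r ≤ ofHeart hrs p :=
  𝓔.le_star_left (by
    obtain ⟨Z, hZ, hT⟩ := p.exists_isZero_T
    exact ⟨Z.obj, (heart r s).ι.map_isZero hZ, Z.property, hT⟩)

theorem ofHeart_le : ofHeart hrs p ≤ s :=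
  (𝓔.star_mono hrs ((ambient_le _).trans inf_le_right)).trans s.T_extClosed

/-- In one direction, an object of the heart lying in `T_r ⋆ X` has no nonzero morphism to `Y`,
because `Y ⊆ Y ⋆ F_s`, so it lies in `X`. In the other, `X ⊆ T_r ⋆ X`. -/
theorem toHeart_ofHeart : toHeart (ofHeart hrs p) (le_ofHeart hrs p) (ofHeart_le hrs p) = p := by
  refine le_antisymm (fun B hB => ?_) (fun B hB => ?_)
  · refine (p.T_iff B).2 fun Y hY f => ObjectProperty.hom_ext _ ?_
    exact star_hom_zero hrs p hB (𝓔.le_star_left s.exists_isZero_F _ ⟨Y.property, hY⟩) f.hom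
  · exact 𝓔.le_star_right r.exists_isZero_T _ ⟨B.property, hB⟩

/-- On torsion classes this is `star_T_heart` for the smaller interval `[r, t]`; antisymmetry of the
order then gives equality of pairs. -/
theorem ofHeart_toHeart (t : STors 𝓔) (hrt : r ≤ t) (hts : t ≤ s) :
    ofHeart hrs (toHeart t hrt hts) = t := by
  have h : (ofHeart hrs (toHeart t hrt hts)).T = t.T := by
    change 𝓔.star r.T (ambient (toHeart t hrt hts).T) = t.T
    rw [ambient_toHeart_T, inf_comm]
    exact star_T_heart hrt
  exact le_antisymm (α := STors 𝓔) h.le h.ge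

/-- The isomorphism between the interval `[r, s]` and the poset of `s`-torsion pairs in its
heart. -/
def heartOrderIso : Set.Icc r s ≃o STors (heartStructure r s) where
  toFun t := toHeart t.1 t.2.1 t.2.2
  invFun p := ⟨ofHeart hrs p, le_ofHeart hrs p, ofHeart_le hrs p⟩
  left_inv t := Subtype.ext (ofHeart_toHeart hrs t.1 t.2.1 t.2.2)
  right_inv p := toHeart_ofHeart hrs p
  map_rel_iff' {t t'} := by
    refine ⟨fun h => ?_, fun h A hA => h _ hA⟩
    change t.1.T ≤ t'.1.T
    -- A torsion class in the interval is recovered from its trace on `F_r`, so an inclusion of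
    -- traces gives an inclusion of torsion classes.
    rw [← star_T_heart t.2.1, ← star_T_heart t'.2.1]
    exact 𝓔.star_mono le_rfl fun A hA => ⟨hA.1, h ⟨A, hA.1, t.2.2 _ hA.2⟩ hA.2⟩

end ofHeart

/-! ### Restriction to subintervals sharing an endpoint with `[x, z]` -/

variable {x y z : STors 𝓔}

theorem toHeart_mem_heartPlus {t : STors 𝓔} (hxt : x ≤ t) (hty : t ≤ y) (hyz : y ≤ z) :
    toHeart t hxt (hty.trans hyz) ∈ heartPlus x y z := fun _ h => ⟨h.1.1, hty _ h.2⟩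

theorem toHeart_mem_heartMinus {t : STors 𝓔} (hxy : x ≤ y) (hyt : y ≤ t) (htz : t ≤ z) :
    toHeart t (hxy.trans hyt) htz ∈ heartMinus x y z := fun _ h =>
  ⟨⟨h.1, htz _ (hyt _ h.2)⟩, hyt _ h.2⟩

/-- Apply `T_x ⋆ -` to the inclusion defining `heartPlus` and use `T_x ⋆ H_[x,y] = T_y`. The same
argument with inclusions reversed treats `heartMinus`. -/
theorem ofHeart_le_of_mem_heartPlus (hxy : x ≤ y) (hxz : x ≤ z) {p : STors (heartStructure x z)}
    (hp : p ∈ heartPlus x y z) : ofHeart hxz p ≤ y :=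
  (𝓔.star_mono le_rfl hp).trans (star_T_heart hxy).le

theorem le_ofHeart_of_mem_heartMinus (hxy : x ≤ y) (hxz : x ≤ z) {p : STors (heartStructure x z)}
    (hp : p ∈ heartMinus x y z) : y ≤ ofHeart hxz p :=
  (star_T_heart hxy).ge.trans (𝓔.star_mono le_rfl hp)

/-- The isomorphism `[x, y] ≅ stors H⁺_[x,y,z]`. -/
def heartPlusOrderIso (hxy : x ≤ y) (hyz : y ≤ z) : Set.Icc x y ≃o heartPlus x y z where
  toFun t := ⟨toHeart t.1 t.2.1 (t.2.2.trans hyz), toHeart_mem_heartPlus t.2.1 t.2.2 hyz⟩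
  invFun p := ⟨ofHeart (hxy.trans hyz) p.1, le_ofHeart _ p.1,
    ofHeart_le_of_mem_heartPlus hxy _ p.2⟩
  left_inv t := Subtype.ext (ofHeart_toHeart (hxy.trans hyz) t.1 t.2.1 (t.2.2.trans hyz))
  right_inv p := Subtype.ext (toHeart_ofHeart (hxy.trans hyz) p.1)
  -- Both orders are induced from the larger interval `[x, z]` and its heart.
  map_rel_iff' {t t'} := (heartOrderIso (hxy.trans hyz)).le_iff_le
    (x := ⟨t.1, t.2.1, t.2.2.trans hyz⟩) (y := ⟨t'.1, t'.2.1, t'.2.2.trans hyz⟩)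

theorem ambient_heartPlusOrderIso_T (hxy : x ≤ y) (hyz : y ≤ z) (t : Set.Icc x y) :
    ambient (heartPlusOrderIso hxy hyz t).1.T = t.1.T ⊓ x.F :=
  ambient_toHeart_T t.2.1 (t.2.2.trans hyz)

theorem ambient_heartPlusOrderIso_F (hxy : x ≤ y) (hyz : y ≤ z) (t : Set.Icc x y) :
    ambient (heartPlusOrderIso hxy hyz t).1.F = z.T ⊓ t.1.F :=
  ambient_toHeart_F t.2.1 (t.2.2.trans hyz)

/-- The isomorphism `[y, z] ≅ stors H⁻_[x,y,z]`. -/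
def heartMinusOrderIso (hxy : x ≤ y) (hyz : y ≤ z) : Set.Icc y z ≃o heartMinus x y z where
  toFun t := ⟨toHeart t.1 (hxy.trans t.2.1) t.2.2, toHeart_mem_heartMinus hxy t.2.1 t.2.2⟩
  invFun p := ⟨ofHeart (hxy.trans hyz) p.1, le_ofHeart_of_mem_heartMinus hxy _ p.2,
    ofHeart_le _ p.1⟩
  left_inv t := Subtype.ext (ofHeart_toHeart (hxy.trans hyz) t.1 (hxy.trans t.2.1) t.2.2)
  right_inv p := Subtype.ext (toHeart_ofHeart (hxy.trans hyz) p.1)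
  map_rel_iff' {t t'} := (heartOrderIso (hxy.trans hyz)).le_iff_le
    (x := ⟨t.1, hxy.trans t.2.1, t.2.2⟩) (y := ⟨t'.1, hxy.trans t'.2.1, t'.2.2⟩)

theorem ambient_heartMinusOrderIso_T (hxy : x ≤ y) (hyz : y ≤ z) (t : Set.Icc y z) :
    ambient (heartMinusOrderIso hxy hyz t).1.T = t.1.T ⊓ x.F :=
  ambient_toHeart_T (hxy.trans t.2.1) t.2.2

theorem ambient_heartMinusOrderIso_F (hxy : x ≤ y) (hyz : y ≤ z) (t : Set.Icc y z) :
    ambient (heartMinusOrderIso hxy hyz t).1.F = z.T ⊓ t.1.F :=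
  ambient_toHeart_F (hxy.trans t.2.1) t.2.2

end STors

end

end STorsion

/-! ### The theorem -/

theorem theorem3p16 {D : Type u} [Category.{v} D] [Preadditive D] [HasZeroObject D]
    [HasBinaryBiproducts D] (𝓔 : STorsion.NegExtriangulated.{w, w'} D)
    (t₁ t₂ t₃ t₄ : STorsion.STors 𝓔) (h₁₂ : t₁ ≤ t₂) (h₂₃ : t₂ ≤ t₃) (h₃₄ : t₃ ≤ t₄) :
    -- (a)
    (∃ Φr : Set.Icc t₂ t₃ ≃o STorsion.STors.heartPlus t₂ t₃ t₄,
      (∀ t : Set.Icc t₂ t₃,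
        STorsion.STors.ambient (Φr t).1.T = t.1.T ⊓ t₂.F ∧
        STorsion.STors.ambient (Φr t).1.F = t₄.T ⊓ t.1.F) ∧
      (∀ p : STorsion.STors.heartPlus t₂ t₃ t₄,
        (Φr.symm p).1.T = 𝓔.star t₂.T (STorsion.STors.ambient p.1.T) ∧
        (Φr.symm p).1.F = 𝓔.star (STorsion.STors.ambient p.1.F) t₄.F)) ∧
    -- (b)
    (∃ Φl : Set.Icc t₂ t₃ ≃o STorsion.STors.heartMinus t₁ t₂ t₃,
      (∀ t : Set.Icc t₂ t₃,
        STorsion.STors.ambient (Φl t).1.T = t.1.T ⊓ t₁.F ∧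
        STorsion.STors.ambient (Φl t).1.F = t₃.T ⊓ t.1.F) ∧
      (∀ p : STorsion.STors.heartMinus t₁ t₂ t₃,
        (Φl.symm p).1.T = 𝓔.star t₁.T (STorsion.STors.ambient p.1.T) ∧
        (Φl.symm p).1.F = 𝓔.star (STorsion.STors.ambient p.1.F) t₃.F)) ∧
    -- (c)
    (∃ ε : STorsion.STors.heartPlus t₂ t₃ t₄ ≃o STorsion.STors.heartMinus t₁ t₂ t₃,
      (∀ p : STorsion.STors.heartPlus t₂ t₃ t₄,
        STorsion.STors.ambient (ε p).1.T =
          𝓔.star t₂.T (STorsion.STors.ambient p.1.T) ⊓ t₁.F ∧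
        STorsion.STors.ambient (ε p).1.F =
          𝓔.star (STorsion.STors.ambient p.1.F) t₄.F ⊓ t₃.T) ∧
      (∀ q : STorsion.STors.heartMinus t₁ t₂ t₃,
        STorsion.STors.ambient (ε.symm q).1.T =
          𝓔.star t₁.T (STorsion.STors.ambient q.1.T) ⊓ t₂.F ∧
        STorsion.STors.ambient (ε.symm q).1.F =
          𝓔.star (STorsion.STors.ambient q.1.F) t₃.F ⊓ t₄.T)) := by
  let Φr := STorsion.STors.heartPlusOrderIso h₂₃ h₃₄
  let Φl := STorsion.STors.heartMinusOrderIso h₁₂ h₂₃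
  have hrT : ∀ t, STorsion.STors.ambient (Φr t).1.T = t.1.T ⊓ t₂.F :=
    STorsion.STors.ambient_heartPlusOrderIso_T h₂₃ h₃₄
  have hrF : ∀ t, STorsion.STors.ambient (Φr t).1.F = t₄.T ⊓ t.1.F :=
    STorsion.STors.ambient_heartPlusOrderIso_F h₂₃ h₃₄
  have hlT : ∀ t, STorsion.STors.ambient (Φl t).1.T = t.1.T ⊓ t₁.F :=
    STorsion.STors.ambient_heartMinusOrderIso_T h₁₂ h₂₃
  have hlF : ∀ t, STorsion.STors.ambient (Φl t).1.F = t₃.T ⊓ t.1.F :=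
    STorsion.STors.ambient_heartMinusOrderIso_F h₁₂ h₂₃
  -- The formulas for the inverses hold by definition of `ofHeart`. In (c), both formulas for `Φl ∘
  -- Φr⁻¹` and for its inverse follow from those in (a) and (b), up to the order of the
  -- intersection.
  exact ⟨⟨Φr, fun t => ⟨hrT t, hrF t⟩, fun p => ⟨rfl, rfl⟩⟩,
    ⟨Φl, fun t => ⟨hlT t, hlF t⟩, fun p => ⟨rfl, rfl⟩⟩,
    ⟨Φr.symm.trans Φl,
      fun p => ⟨hlT (Φr.symm p), (hlF (Φr.symm p)).trans (inf_comm _ _)⟩,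
      fun q => ⟨hrT (Φl.symm q), (hrF (Φl.symm q)).trans (inf_comm _ _)⟩⟩⟩
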